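/- Let $\lambda$ be the Lebesgue measure on $\mathbb R^2$. For $(x,u)\in\mathbb R^2$ let $\mathbb P^+_{x,u}$ be the law, on the space of continuous paths $[0,\infty)\to\mathbb R^2$ (with the $\sigma$-algebra generated by the coordinates), of the Kolmogorov process $(Y_s,W_s)_{s\ge 0}$ started from $(x,u)$, that is, $W_s=u+B_s$ with $B$ a standard one-dimensional Brownian motion and $Y_s=x+\int_0^s W_r\,dr$. Let $\mathbb P^+_\lambda=\int_{\mathbb R^2}\lambda(dx,du)\,\mathbb P^+_{x,u}$, a $\sigma$-finite measure on this path space, and write $(Y_s,W_s)_{s\ge0}$ also for the coordinate process. Then for every $t>0$: 1) (Stationarity) the law of the process $(Y_{t+s},W_{t+s})_{s\ge 0}$ under $\mathbb P^+_\lambda$ is $\mathbb P^+_\lambda$; 2) (Duality) the laws of the processes $(Y_{t-s},-W_{t-s})_{0\le s\le t}$ and $(Y_s,W_s)_{0\le s\le t}$ under $\mathbb P^+_\lambda$ are the same. -/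

import Mathlib

open MeasureTheory ProbabilityTheory
open scoped NNReal

namespace Kolmogorov

/-- The space `C(T, E)` of continuous paths carries the σ-algebra generated by the evaluation maps
`γ ↦ γ t`. -/
instance pathMeasurableSpace {T E : Type*} [TopologicalSpace T] [TopologicalSpace E]
    [MeasurableSpace E] : MeasurableSpace C(T, E) :=
  MeasurableSpace.comap (fun (γ : C(T, E)) (t : T) ↦ γ t) MeasurableSpace.pi

/-- The trajectory of the Kolmogorov process with initial condition `z = (x, u)` driven by the
path `b`: it is `t ↦ (Y t, W t)` with `W t = u + b t` and `Y t = x + ∫ s in 0..t, W s`. -/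
noncomputable def path (z : ℝ × ℝ) (b : C(ℝ≥0, ℝ)) : C(ℝ≥0, ℝ × ℝ) where
  toFun t := (z.1 + ∫ s in (0 : ℝ)..(t : ℝ), (z.2 + b s.toNNReal), z.2 + b t)
  continuous_toFun := by
    have h : Continuous fun s : ℝ ↦ z.2 + b s.toNNReal := by fun_prop
    have h' := intervalIntegral.continuous_primitive (μ := volume)
      (fun a c ↦ h.intervalIntegrable a c) 0
    exact (continuous_const.add (h'.comp NNReal.continuous_coe)).prodMk (by fun_prop)

open Classical in
/-- The trajectory `t ↦ B t ω` as a continuous path (set to `0` at those `ω` where the trajectory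
is not continuous, a null event for a Brownian motion `B`). -/
noncomputable def trajectory {Ω : Type*} (B : ℝ≥0 → Ω → ℝ) (ω : Ω) : C(ℝ≥0, ℝ) :=
  if h : Continuous (fun t ↦ B t ω) then ⟨fun t ↦ B t ω, h⟩ else 0

/-- `ℙ⁺_{x,u}`, the law on path space of the Kolmogorov process started from `z = (x, u)`,
where `B` is a standard Brownian motion under `P`. -/
noncomputable def law {Ω : Type*} [MeasurableSpace Ω] (B : ℝ≥0 → Ω → ℝ) (P : Measure Ω)
    (z : ℝ × ℝ) : Measure C(ℝ≥0, ℝ × ℝ) :=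
  P.map fun ω ↦ path z (trajectory B ω)

/-- `ℙ⁺_λ = ∫ λ(dx,du) ℙ⁺_{x,u}`, with `λ` the Lebesgue measure on `ℝ²`. -/
noncomputable def lebesgueLaw {Ω : Type*} [MeasurableSpace Ω] (B : ℝ≥0 → Ω → ℝ)
    (P : Measure Ω) : Measure C(ℝ≥0, ℝ × ℝ) :=
  (volume : Measure (ℝ × ℝ)).bind (law B P)

/-- The shifted path `s ↦ γ (t + s)`, `s ≥ 0`. -/
def shift (t : ℝ≥0) (γ : C(ℝ≥0, ℝ × ℝ)) : C(ℝ≥0, ℝ × ℝ) where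
  toFun s := γ (t + s)
  continuous_toFun := by fun_prop

/-- The restricted path `s ↦ γ s`, `0 ≤ s ≤ t`. -/
def restrict (t : ℝ≥0) (γ : C(ℝ≥0, ℝ × ℝ)) : C(Set.Icc 0 t, ℝ × ℝ) where
  toFun s := γ s
  continuous_toFun := by fun_prop

/-- The time-reversed conjugated path: `γ = (Y, W)` is sent to `s ↦ (Y (t - s), -W (t - s))`,
`0 ≤ s ≤ t`. -/
def reverseConj (t : ℝ≥0) (γ : C(ℝ≥0, ℝ × ℝ)) : C(Set.Icc 0 t, ℝ × ℝ) where
  toFun s := ((γ (t - s)).1, -(γ (t - s)).2)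
  continuous_toFun := by fun_prop

/-- The evaluation maps on path space are measurable. -/
theorem measurable_eval {T E : Type*} [TopologicalSpace T] [TopologicalSpace E]
    [MeasurableSpace E] (t : T) : Measurable fun γ : C(T, E) ↦ γ t :=
  (measurable_pi_apply t).comp (comap_measurable _)

/-- A map into path space is measurable as soon as all its coordinates are. -/
theorem measurable_to_path {T E α : Type*} [TopologicalSpace T] [TopologicalSpace E]
    [MeasurableSpace E] [MeasurableSpace α] {f : α → C(T, E)}
    (h : ∀ t, Measurable fun a ↦ f a t) : Measurable f := by
  rintro _ ⟨s, hs, rfl⟩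
  exact (measurable_pi_lambda _ h) hs

/-- The trajectory of the Kolmogorov process is jointly measurable in its initial condition and
the driving path. -/
theorem measurable_path : Measurable fun q : (ℝ × ℝ) × C(ℝ≥0, ℝ) ↦ path q.1 q.2 := by
  refine measurable_to_path fun t ↦ ?_
  have h0 : Measurable (Function.uncurry
      fun (s : ℝ) (q : (ℝ × ℝ) × C(ℝ≥0, ℝ)) ↦ q.1.2 + q.2 s.toNNReal) :=
    measurable_uncurry_of_continuous_of_measurable (fun q ↦ by fun_prop)
      fun s ↦ by
        have h : Measurable fun q : (ℝ × ℝ) × C(ℝ≥0, ℝ) ↦ q.2 s.toNNReal :=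
          (measurable_eval s.toNNReal).comp measurable_snd
        exact (measurable_snd.comp measurable_fst).add h
  have h1 : Measurable fun q : (ℝ × ℝ) × C(ℝ≥0, ℝ) ↦
      ∫ s in (0 : ℝ)..(t : ℝ), (q.1.2 + q.2 s.toNNReal) := by
    simp_rw [intervalIntegral.integral_of_le t.coe_nonneg]
    exact (h0.comp measurable_swap).stronglyMeasurable.integral_prod_right'.measurable
  exact ((measurable_fst.comp measurable_fst).add h1).prodMk
    ((measurable_snd.comp measurable_fst).add ((measurable_eval t).comp measurable_snd))

/-- The trajectory of a Brownian motion is a random variable with values in path space. -/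
theorem aemeasurable_trajectory {Ω : Type*} [MeasurableSpace Ω] {B : ℝ≥0 → Ω → ℝ}
    {P : Measure Ω} (hB : IsBrownianReal B P) : AEMeasurable (trajectory B) P := by
  classical
  obtain ⟨D, hDc, hD⟩ := TopologicalSpace.exists_countable_dense ℝ≥0
  have hm := fun t ↦ hB.toIsPreBrownianReal.aemeasurable t
  have hae : ∀ᵐ ω ∂P, Continuous (B · ω) ∧ ∀ q ∈ D, B q ω = (hm q).mk _ ω :=
    hB.cont.and ((ae_ball_iff hDc).2 fun q _ ↦ (hm q).ae_eq_mk)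
  set N := toMeasurable P {ω | ¬ (Continuous (B · ω) ∧ ∀ q ∈ D, B q ω = (hm q).mk _ ω)} with hN
  have hN0 : P N = 0 := by rw [hN, measure_toMeasurable]; exact hae
  have hNm : MeasurableSet N := measurableSet_toMeasurable _ _
  have hgood : ∀ ω ∉ N, Continuous (B · ω) ∧ ∀ q ∈ D, B q ω = (hm q).mk _ ω := by
    intro ω hω
    by_contra h
    exact hω (subset_toMeasurable _ _ h)
  refine ⟨fun ω ↦ if ω ∈ N then 0 else trajectory B ω, measurable_to_path fun t ↦ ?_, ?_⟩
  · obtain ⟨q, hq, hqt⟩ := mem_closure_iff_seq_limit.1 (hD t)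
    refine measurable_of_tendsto_metrizable
      (f := fun n ω ↦ if ω ∈ N then 0 else (hm (q n)).mk _ ω)
      (fun n ↦ Measurable.ite hNm measurable_const (hm (q n)).measurable_mk) ?_
    refine tendsto_pi_nhds.2 fun ω ↦ ?_
    by_cases hω : ω ∈ N
    · simp [hω]
    · obtain ⟨hc, he⟩ := hgood ω hω
      simp only [hω, if_false, trajectory, hc, dif_pos, ContinuousMap.coe_mk]
      refine ((hc.tendsto t).comp hqt).congr fun n ↦ ?_
      exact he _ (hq n)
  · filter_upwards [measure_eq_zero_iff_ae_notMem.1 hN0] with ω hω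
    simp [hω]

/-- The kernel property of `z ↦ ℙ⁺_z`, which gives its integral against Lebesgue measure
a meaning. -/
theorem measurable_law {Ω : Type*} [MeasurableSpace Ω] {B : ℝ≥0 → Ω → ℝ}
    {P : Measure Ω} (hB : IsBrownianReal B P) : Measurable (law B P) := by
  have : IsProbabilityMeasure P := hB.toIsPreBrownianReal.isGaussianProcess.isProbabilityMeasure
  have h : law B P = fun z ↦ (P.map (trajectory B)).map (path z) := by
    ext1 z
    exact (AEMeasurable.map_map_of_aemeasurable
      (measurable_path.comp measurable_prodMk_left).aemeasurable (aemeasurable_trajectory hB)).symm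
  rw [h]
  have := Measure.isProbabilityMeasure_map (aemeasurable_trajectory hB)
  refine Measure.measurable_of_measurable_coe _ fun s hs ↦ ?_
  have h' := measurable_measure_prodMk_left (ν := P.map (trajectory B)) (measurable_path hs)
  have h'' : ∀ z, (P.map (trajectory B)).map (path z) s = P.map (trajectory B)
      (Prod.mk z ⁻¹' ((fun q : (ℝ × ℝ) × C(ℝ≥0, ℝ) ↦ path q.1 q.2) ⁻¹' s)) := fun z ↦ by
    have hz : Measurable (path z) := measurable_path.comp measurable_prodMk_left
    rw [Measure.map_apply hz hs]
    rfl
  simpa only [h''] using h'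

/-- `ℙ⁺_λ(A) = ∫ ℙ⁺_{x,u}(A) dx du`. -/
theorem lebesgueLaw_apply {Ω : Type*} [MeasurableSpace Ω] {B : ℝ≥0 → Ω → ℝ} {P : Measure Ω}
    (hB : IsBrownianReal B P) {A : Set C(ℝ≥0, ℝ × ℝ)} (hA : MeasurableSet A) :
    lebesgueLaw B P A = ∫⁻ z : ℝ × ℝ, law B P z A :=
  Measure.bind_apply hA (measurable_law hB).aemeasurable

theorem measurable_shift (t : ℝ≥0) : Measurable (shift t) :=
  measurable_to_path fun s ↦ measurable_eval (t + s)

theorem measurable_restrict (t : ℝ≥0) : Measurable (restrict t) :=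
  measurable_to_path fun s ↦ measurable_eval (s : ℝ≥0)

theorem measurable_reverseConj (t : ℝ≥0) : Measurable (reverseConj t) :=
  measurable_to_path fun s ↦
    (measurable_eval (t - s : ℝ≥0)).fst.prodMk (measurable_eval (t - s : ℝ≥0)).snd.neg

end Kolmogorov

/-!
Let `ν` be the Wiener measure. The measure `ℙ⁺_λ` is the image of `ν ⊗ λ` under
`(b, z) ↦ path z b`, and both claims come from transformations of `(b, z)` that preserve `ν ⊗ λ`.

For a fixed driving path `b`, the flow `z ↦ path z b t` is `(x, u) ↦ (x + h u, u + b t)`, with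
`h u = ∫ s in 0..t, (u + b s)`: a shear composed with a translation, so it preserves Lebesgue
measure, as does its composition with the conjugation `(x, u) ↦ (x, -u)`. Hence a skew product of
this flow with a map of the driving path preserves `ν ⊗ λ` as soon as the map of driving paths
preserves `ν`; the independence of the past and the future of `b` is not needed.

* Stationarity: the path shifted by `t` is the Kolmogorov path started from `path z b t` and driven
  by `s ↦ b (t + s) - b t`, which is again a Brownian motion.
* Duality: on `[0, t]`, the reversed conjugated path is the Kolmogorov path started from the
  conjugate of `path z b t` and driven by `s ↦ b t - b (t - s)`. This extends to the process
  `s ↦ b (max s t) - b (t - s)` on `[0, ∞)` (with truncated subtraction), which is centered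
  Gaussian with covariance `min`, hence again a Brownian motion.
-/

namespace Kolmogorov

/-- The law of a path-valued random variable that is a Brownian motion is unique. -/
theorem map_eq_map_of_isPreBrownianReal {Ω Ω' : Type*} [MeasurableSpace Ω] [MeasurableSpace Ω']
    {P : Measure Ω} {P' : Measure Ω'} {X : Ω → C(ℝ≥0, ℝ)} {X' : Ω' → C(ℝ≥0, ℝ)}
    (hXm : Measurable X) (hXm' : Measurable X') (hX : IsPreBrownianReal (fun t ω ↦ X ω t) P)
    (hX' : IsPreBrownianReal (fun t ω ↦ X' ω t) P') : P.map X = P'.map X' := by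
  have hc : Measurable fun (b : C(ℝ≥0, ℝ)) (t : ℝ≥0) ↦ b t :=
    measurable_pi_lambda _ measurable_eval
  have key : (P.map X).map (fun b t ↦ b t) = (P'.map X').map (fun b t ↦ b t) := by
    rw [Measure.map_map hc hXm, Measure.map_map hc hXm']
    refine IsProjectiveLimit.unique (P := BrownianReal.projectiveFamily)
      (fun I ↦ ?_) fun I ↦ ?_
    · rw [Measure.map_map (Finset.measurable_restrict _) (hc.comp hXm)]
      exact (hX.hasLaw I).map_eq
    · rw [Measure.map_map (Finset.measurable_restrict _) (hc.comp hXm')]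
      exact (hX'.hasLaw I).map_eq
  ext s hs
  obtain ⟨A, hA, rfl⟩ := hs
  rw [← Measure.map_apply hc hA, ← Measure.map_apply hc hA, key]

/-- The coordinate process is a Brownian motion under the law of the trajectory of a Brownian
motion. -/
theorem isPreBrownianReal_map_trajectory {Ω : Type*} [MeasurableSpace Ω] {B : ℝ≥0 → Ω → ℝ}
    {P : Measure Ω} (hB : IsBrownianReal B P) :
    IsPreBrownianReal (fun t (b : C(ℝ≥0, ℝ)) ↦ b t) (P.map (trajectory B)) where
  hasLaw I := by
    have hm : Measurable fun (b : C(ℝ≥0, ℝ)) ↦ I.restrict (fun t ↦ b t) :=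
      measurable_pi_lambda _ fun i ↦ measurable_eval (i : ℝ≥0)
    refine ⟨hm.aemeasurable, ?_⟩
    rw [AEMeasurable.map_map_of_aemeasurable hm.aemeasurable (aemeasurable_trajectory hB),
      ← (hB.hasLaw I).map_eq]
    refine Measure.map_congr ?_
    filter_upwards [hB.cont] with ω hω
    simp [trajectory, hω]

/-- `ℙ⁺_λ` is the image of the product of the Wiener measure and Lebesgue measure. The driving path
is the first factor, as it is the base of the skew products below. -/
theorem lebesgueLaw_eq_map_prod {Ω : Type*} [MeasurableSpace Ω] {B : ℝ≥0 → Ω → ℝ}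
    {P : Measure Ω} (hB : IsBrownianReal B P) :
    lebesgueLaw B P = ((P.map (trajectory B)).prod (volume : Measure (ℝ × ℝ))).map
      fun p ↦ path p.2 p.1 := by
  have : IsProbabilityMeasure P := hB.toIsPreBrownianReal.isGaussianProcess.isProbabilityMeasure
  have := Measure.isProbabilityMeasure_map (aemeasurable_trajectory hB)
  have hm : Measurable fun p : C(ℝ≥0, ℝ) × (ℝ × ℝ) ↦ path p.2 p.1 :=
    measurable_path.comp measurable_swap
  ext s hs
  rw [lebesgueLaw_apply hB hs, Measure.map_apply hm hs, Measure.prod_apply_symm (hm hs)]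
  refine lintegral_congr fun z ↦ ?_
  have hz : Measurable (path z) := measurable_path.comp measurable_prodMk_left
  have h : law B P z = (P.map (trajectory B)).map (path z) :=
    (AEMeasurable.map_map_of_aemeasurable hz.aemeasurable (aemeasurable_trajectory hB)).symm
  rw [h, Measure.map_apply hz hs]
  rfl

/-- The increments `s ↦ b (t + s) - b t` of the path `b` after time `t`. -/
def increments (t : ℝ≥0) (b : C(ℝ≥0, ℝ)) : C(ℝ≥0, ℝ) where
  toFun s := b (t + s) - b t
  continuous_toFun := by fun_prop

/-- The time reversal at `t` of a path `b`. The subtraction `t - s` is truncated, so this is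
`b t - b (t - s)` for `s ≤ t`, continued by `b s - b 0` for `s ≥ t`. -/
def reversal (t : ℝ≥0) (b : C(ℝ≥0, ℝ)) : C(ℝ≥0, ℝ) where
  toFun s := b (max s t) - b (t - s)
  continuous_toFun := by fun_prop

theorem measurable_increments (t : ℝ≥0) : Measurable (increments t) :=
  measurable_to_path fun s ↦ (measurable_eval (t + s)).sub (measurable_eval t)

theorem measurable_reversal (t : ℝ≥0) : Measurable (reversal t) :=
  measurable_to_path fun s ↦ (measurable_eval (max s t)).sub (measurable_eval (t - s))

/-- The time reversal of a Brownian motion is a Brownian motion. -/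
theorem isPreBrownianReal_reversal {Ω : Type*} [MeasurableSpace Ω] {B : ℝ≥0 → Ω → ℝ}
    {P : Measure Ω} (hB : IsPreBrownianReal B P) (t : ℝ≥0) :
    IsPreBrownianReal (fun s ω ↦ B (max s t) ω - B (t - s) ω) P := by
  have := hB.isGaussianProcess.isProbabilityMeasure
  have hL (s : ℝ≥0) : MemLp (B s) 2 P := (hB.isGaussianProcess.hasGaussianLaw_eval s).memLp_two
  refine IsGaussianProcess.isPreBrownianReal_of_covariance ?_ (fun s ↦ ?_) fun r s hrs ↦ ?_
  · exact hB.isGaussianProcess.of_isGaussianProcess fun s ↦ ⟨{max s t, t - s},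
      { toFun x := x ⟨max s t, by simp⟩ - x ⟨t - s, by simp⟩
        map_add' x y := by simp; abel
        map_smul' c x := by simp; ring }, by simp⟩
  · rw [integral_sub (hB.integrable_eval _) (hB.integrable_eval _), hB.integral_eval,
      hB.integral_eval, sub_zero]
  · rw [covariance_fun_sub_left (hL _) (hL _)
        (show MemLp (fun ω ↦ B (max s t) ω - B (t - s) ω) 2 P from (hL _).sub (hL _)),
      covariance_fun_sub_right (hL _) (hL _) (hL _),
      covariance_fun_sub_right (hL _) (hL _) (hL _), hB.covariance_eval, hB.covariance_eval,
      hB.covariance_eval, hB.covariance_eval, min_eq_left (max_le_max_right t hrs),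
      min_eq_right (tsub_le_self.trans (le_max_right r t)),
      min_eq_left (tsub_le_self.trans (le_max_right s t)),
      min_eq_right (tsub_le_tsub_left hrs t)]
    rcases le_total r t with h | h
    · rw [max_eq_right h, NNReal.coe_sub h]; ring
    · rw [max_eq_left h, tsub_eq_zero_of_le h, tsub_eq_zero_of_le (h.trans hrs)]; simp

theorem measurePreserving_increments {Ω : Type*} [MeasurableSpace Ω] {B : ℝ≥0 → Ω → ℝ}
    {P : Measure Ω} (hB : IsBrownianReal B P) (t : ℝ≥0) :
    MeasurePreserving (increments t) (P.map (trajectory B)) (P.map (trajectory B)) := by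
  refine ⟨measurable_increments t, ?_⟩
  have h := isPreBrownianReal_map_trajectory hB
  simpa using map_eq_map_of_isPreBrownianReal (measurable_increments t) measurable_id (h.shift t) h

theorem measurePreserving_reversal {Ω : Type*} [MeasurableSpace Ω] {B : ℝ≥0 → Ω → ℝ}
    {P : Measure Ω} (hB : IsBrownianReal B P) (t : ℝ≥0) :
    MeasurePreserving (reversal t) (P.map (trajectory B)) (P.map (trajectory B)) := by
  refine ⟨measurable_reversal t, ?_⟩
  have h := isPreBrownianReal_map_trajectory hB
  simpa using map_eq_map_of_isPreBrownianReal (measurable_reversal t) measurable_id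
    (isPreBrownianReal_reversal h t) h

/-- A shear in the first coordinate, over a measure-preserving map of the second coordinate,
preserves Lebesgue measure on the plane. -/
theorem measurePreserving_shear {h f : ℝ → ℝ} (hh : Measurable h)
    (hf : MeasurePreserving f volume volume) :
    MeasurePreserving (fun z : ℝ × ℝ ↦ (z.1 + h z.2, f z.2)) volume volume := by
  have hs : MeasurePreserving (fun p : ℝ × ℝ ↦ (f p.1, p.2 + h p.1))
      (volume.prod volume) (volume.prod volume) :=
    hf.skew_product (g := fun u x ↦ x + h u) (measurable_snd.add (hh.comp measurable_fst))
      (.of_forall fun u ↦ (measurePreserving_add_right volume (h u)).map_eq)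
  exact (Measure.measurePreserving_swap.comp hs).comp Measure.measurePreserving_swap

theorem measurable_integral_const_add (t : ℝ≥0) (b : C(ℝ≥0, ℝ)) :
    Measurable fun u : ℝ ↦ ∫ s in (0 : ℝ)..(t : ℝ), (u + b s.toNNReal) :=
  (intervalIntegral.continuous_parametric_intervalIntegral_of_continuous'
    (by fun_prop) _ _).measurable

/-- The flow at time `t` driven by a fixed path preserves Lebesgue measure. -/
theorem measurePreserving_path (t : ℝ≥0) (b : C(ℝ≥0, ℝ)) :
    MeasurePreserving (fun z ↦ path z b t) volume volume :=
  measurePreserving_shear (measurable_integral_const_add t b)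
    (measurePreserving_add_right volume (b t))

theorem measurePreserving_conj_path (t : ℝ≥0) (b : C(ℝ≥0, ℝ)) :
    MeasurePreserving (fun z ↦ ((path z b t).1, -(path z b t).2)) volume volume :=
  measurePreserving_shear (measurable_integral_const_add t b)
    ((Measure.measurePreserving_neg volume).comp (measurePreserving_add_right volume (b t)))

/-- The flow property. -/
theorem shift_path (t : ℝ≥0) (z : ℝ × ℝ) (b : C(ℝ≥0, ℝ)) :
    shift t (path z b) = path (path z b t) (increments t b) := by
  ext s
  · have hc : Continuous fun r : ℝ ↦ z.2 + b r.toNNReal := by fun_prop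
    have h : ∫ r in (0 : ℝ)..s, (z.2 + b t + (b (t + r.toNNReal) - b t))
        = ∫ r in (t : ℝ)..(t + s : ℝ), (z.2 + b r.toNNReal) := by
      have h1 := intervalIntegral.integral_comp_add_left (a := 0) (b := (s : ℝ))
        (fun r : ℝ ↦ z.2 + b r.toNNReal) (t : ℝ)
      rw [add_zero] at h1
      rw [← h1]
      refine intervalIntegral.integral_congr fun r hr ↦ ?_
      rw [Set.uIcc_of_le s.coe_nonneg] at hr
      simp only [Real.toNNReal_add t.coe_nonneg hr.1, Real.toNNReal_coe]
      ring
    simp only [shift, path, increments, ContinuousMap.coe_mk, NNReal.coe_add]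
    rw [h, add_assoc, intervalIntegral.integral_add_adjacent_intervals
      (hc.intervalIntegrable _ _) (hc.intervalIntegrable _ _)]
  · simp [shift, path, increments]

/-- The reversed conjugated path is again a Kolmogorov path up to time `t`. -/
theorem reverseConj_path (t : ℝ≥0) (z : ℝ × ℝ) (b : C(ℝ≥0, ℝ)) :
    reverseConj t (path z b) =
      restrict t (path ((path z b t).1, -(path z b t).2) (reversal t b)) := by
  ext s
  · obtain ⟨s, -, hst⟩ := s
    have hc : Continuous fun r : ℝ ↦ z.2 + b r.toNNReal := by fun_prop
    have h : ∫ r in (0 : ℝ)..s,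
          (-(z.2 + b t) + (b (max r.toNNReal t) - b (t - r.toNNReal)))
        = -∫ r in (t - s : ℝ)..t, (z.2 + b r.toNNReal) := by
      have h1 := intervalIntegral.integral_comp_sub_left (a := 0) (b := (s : ℝ))
        (fun r : ℝ ↦ z.2 + b r.toNNReal) (t : ℝ)
      rw [sub_zero] at h1
      rw [← h1, ← intervalIntegral.integral_neg]
      refine intervalIntegral.integral_congr fun r hr ↦ ?_
      rw [Set.uIcc_of_le s.coe_nonneg] at hr
      have hrt : r.toNNReal ≤ t := (Real.toNNReal_le_iff_le_coe.2 hr.2).trans hst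
      have hsub : (t - r : ℝ).toNNReal = t - r.toNNReal := by
        rw [NNReal.sub_def, Real.coe_toNNReal r hr.1]
      simp only [max_eq_right hrt, hsub]
      ring
    simp only [reverseConj, restrict, path, reversal, ContinuousMap.coe_mk, NNReal.coe_sub hst]
    rw [h, ← intervalIntegral.integral_add_adjacent_intervals
      (hc.intervalIntegrable 0 (t - s : ℝ)) (hc.intervalIntegrable (t - s : ℝ) t)]
    ring
  · obtain ⟨s, -, hst⟩ := s
    simp only [reverseConj, restrict, path, reversal, ContinuousMap.coe_mk, max_eq_right hst]
    ring

/-- The transformation of driving path and initial condition given by a measure-preserving map of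
driving paths and by fiberwise volume-preserving maps of initial conditions does not change the
law of the Kolmogorov path. -/
theorem lebesgueLaw_eq_map_skewProduct {Ω : Type*} [MeasurableSpace Ω] {B : ℝ≥0 → Ω → ℝ}
    {P : Measure Ω} (hB : IsBrownianReal B P) {f : C(ℝ≥0, ℝ) → C(ℝ≥0, ℝ)}
    {g : C(ℝ≥0, ℝ) → ℝ × ℝ → ℝ × ℝ}
    (hf : MeasurePreserving f (P.map (trajectory B)) (P.map (trajectory B)))
    (hgm : Measurable (Function.uncurry g)) (hg : ∀ b, MeasurePreserving (g b) volume volume) :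
    lebesgueLaw B P = ((P.map (trajectory B)).prod (volume : Measure (ℝ × ℝ))).map
      fun p ↦ path (g p.1 p.2) (f p.1) := by
  have : IsProbabilityMeasure P := hB.toIsPreBrownianReal.isGaussianProcess.isProbabilityMeasure
  have := Measure.isProbabilityMeasure_map (aemeasurable_trajectory hB)
  have hs := hf.skew_product hgm (.of_forall fun b ↦ (hg b).map_eq)
  rw [lebesgueLaw_eq_map_prod hB]
  conv_lhs => rw [← hs.map_eq]
  exact Measure.map_map (measurable_path.comp measurable_swap) hs.measurable

end Kolmogorov

/-- Stationarity and duality of the Kolmogorov process under `ℙ⁺_λ`. -/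
theorem corollary1 {Ω : Type*} [MeasurableSpace Ω] {P : Measure Ω} {B : ℝ≥0 → Ω → ℝ}
    (hB : IsBrownianReal B P) (t : ℝ≥0) (ht : 0 < t) :
    (Kolmogorov.lebesgueLaw B P).map (Kolmogorov.shift t) = Kolmogorov.lebesgueLaw B P ∧
    (Kolmogorov.lebesgueLaw B P).map (Kolmogorov.reverseConj t) =
      (Kolmogorov.lebesgueLaw B P).map (Kolmogorov.restrict t) := by
  have hpath : Measurable fun p : C(ℝ≥0, ℝ) × (ℝ × ℝ) ↦ Kolmogorov.path p.2 p.1 :=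
    Kolmogorov.measurable_path.comp measurable_swap
  have hev : Measurable fun p : C(ℝ≥0, ℝ) × (ℝ × ℝ) ↦ Kolmogorov.path p.2 p.1 t :=
    (Kolmogorov.measurable_eval t).comp hpath
  constructor
  · conv_rhs => rw [Kolmogorov.lebesgueLaw_eq_map_skewProduct hB
      (Kolmogorov.measurePreserving_increments hB t) (g := fun b z ↦ Kolmogorov.path z b t) hev
      (Kolmogorov.measurePreserving_path t)]
    rw [Kolmogorov.lebesgueLaw_eq_map_prod hB,
      Measure.map_map (Kolmogorov.measurable_shift t) hpath]
    exact congrArg (Measure.map · _) (funext fun p ↦ Kolmogorov.shift_path t p.2 p.1)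
  · have hconj : Measurable fun p : C(ℝ≥0, ℝ) × (ℝ × ℝ) ↦
        ((Kolmogorov.path p.2 p.1 t).1, -(Kolmogorov.path p.2 p.1 t).2) :=
      hev.fst.prodMk hev.snd.neg
    have hrev : Measurable fun p : C(ℝ≥0, ℝ) × (ℝ × ℝ) ↦
        Kolmogorov.path ((Kolmogorov.path p.2 p.1 t).1, -(Kolmogorov.path p.2 p.1 t).2)
          (Kolmogorov.reversal t p.1) :=
      Kolmogorov.measurable_path.comp
        (hconj.prodMk ((Kolmogorov.measurable_reversal t).comp measurable_fst))
    conv_rhs => rw [Kolmogorov.lebesgueLaw_eq_map_skewProduct hB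
      (Kolmogorov.measurePreserving_reversal hB t)
      (g := fun b z ↦ ((Kolmogorov.path z b t).1, -(Kolmogorov.path z b t).2)) hconj
      (Kolmogorov.measurePreserving_conj_path t)]
    rw [Kolmogorov.lebesgueLaw_eq_map_prod hB,
      Measure.map_map (Kolmogorov.measurable_reverseConj t) hpath,
      Measure.map_map (Kolmogorov.measurable_restrict t) hrev]
    exact congrArg (Measure.map · _) (funext fun p ↦ Kolmogorov.reverseConj_path t p.2 p.1)
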